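/- **Theorem (Denseness).** Let $F$ be any probability distribution on $\mathbb{R}^2$ with $F([0,\infty)^2)=1$. Then, for any fixed scaling factors $a_1>0$ and $a_2>0$, there exists a sequence of bivariate common-shock phase-type (CSPH) distributions with scaling factors $a_1,a_2$ that converges weakly to $F$. Here a *subintensity matrix* is a square real matrix with nonpositive diagonal entries, nonnegative off-diagonal entries and nonpositive row sums, all of whose states are transient (from every state a state with strictly negative row sum can be reached through positive entries). A probability distribution on $\mathbb{R}^2$ is a *CSPH distribution with scaling factors $a_1,a_2$* if, for some finite sets $\mathcal{E}$ and $\mathcal{S}$, a probability vector $\boldsymbol\alpha$ on $\mathcal{E}$, subintensity matrices $\boldsymbol T$ on $\mathcal{E}$ and $\boldsymbol Q_1,\boldsymbol Q_2$ on $\mathcal{S}$, and a nonnegative $\mathcal{E}\times\mathcal{S}$ matrix $\boldsymbol U$ with $\boldsymbol T\boldsymbol 1+\boldsymbol U\boldsymbol 1=\boldsymbol 0$, it is the law of $$(X_1,X_2)=(a_1\tau+\tilde\tau_1,\;a_2\tau+\tilde\tau_2)$$ for the following model. Two processes $J_1,J_2$ on $\mathcal{E}\cup\mathcal{S}\cup\{\partial\}$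 coincide, up to and including the time $\tau=\inf\{t\ge 0: J_{1,2}(t)\notin\mathcal{E}\}$, with a Markov jump process $J_{1,2}$ on $\mathcal{E}\cup\mathcal{S}$ that has initial distribution $(\boldsymbol\alpha,\boldsymbol 0)$ and intensity matrix $\begin{pmatrix}\boldsymbol T&\boldsymbol U\\ \boldsymbol 0&\boldsymbol 0\end{pmatrix}$. Put $K=J_{1,2}(\tau)\in\mathcal{S}$. Conditionally on $K=k$, for each $k\in\mathcal{S}$ with $\mathbb{P}(K=k)>0$, the processes $(J_1(\tau+t))_{t\ge0}$ and $(J_2(\tau+t))_{t\ge0}$ are independent of each other and of $J_{1,2}$, and $(J_i(\tau+t))_{t\ge0}$ is a Markov jump process on $\mathcal{S}\cup\{\partial\}$ started in $k$ that moves within $\mathcal{S}$ according to $\boldsymbol Q_i$ and is absorbed in $\partial$ at the rates $-\boldsymbol Q_i\boldsymbol 1$. Finally, $\tilde\tau_i$ is the time until $(J_i(\tau+t))_{t\ge0}$ is absorbed in $\partial$, that is, the time that $J_i$ spends in $\mathcal{S}$ after $\tau$. -/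

import Mathlib

open MeasureTheory ProbabilityTheory Filter Topology
open scoped NNReal ENNReal

noncomputable section

namespace CSPH

/-! ### Finite-state Markov jump processes -/

section JumpProcess

variable {I Ω : Type*}

open Classical in
/-- Transition matrix of the embedded jump chain of an intensity matrix `Q`: from a state `i` with
positive exit rate `-Q i i` the chain jumps to `j ≠ i` with probability `Q i j / (-Q i i)`; a state
with exit rate zero is absorbing. -/
def jumpMatrix (Q : Matrix I I ℝ) (i j : I) : ℝ :=
  if Q i i = 0 then (if i = j then 1 else 0)
  else (if i = j then 0 else Q i j / (-Q i i))

/-- Under `μ`, the process `J` on the finite state space `I` is a time-homogeneous continuous-time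
Markov jump process with intensity matrix `Q` and initial distribution `α`. This is the definition
by jump chain and holding times: `Y n` is the `n`-th visited state and `H n` the time spent
there, `Y` is a discrete-time Markov chain with initial distribution `α` and transition matrix
`jumpMatrix Q`, and given `Y` the holding times are independent, `H n` being exponential with rate
`-Q (Y n) (Y n)` (and infinite if that rate is zero). Once absorbed, `Y` stays constant. -/
def IsMarkovJumpProcess [MeasurableSpace Ω] (μ : Measure Ω) (Q : Matrix I I ℝ) (α : I → ℝ)
    (J : ℝ≥0 → Ω → I) : Prop :=
  (∀ t i, MeasurableSet {ω | J t ω = i}) ∧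
  ∃ (Y : ℕ → Ω → I) (H : ℕ → Ω → ℝ≥0∞),
    (∀ n i, MeasurableSet {ω | Y n ω = i}) ∧
    (∀ n, Measurable (H n)) ∧
    (∀ (n : ℕ) (i : ℕ → I) (s : ℕ → ℝ≥0),
      μ {ω | ∀ m ≤ n, Y m ω = i m ∧ (s m : ℝ≥0∞) < H m ω} =
        ENNReal.ofReal (α (i 0) * (∏ m ∈ Finset.range n, jumpMatrix Q (i m) (i (m + 1))) *
          ∏ m ∈ Finset.range (n + 1), Real.exp (Q (i m) (i m) * (s m : ℝ)))) ∧
    (∀ᵐ ω ∂μ, ∀ (n : ℕ) (t : ℝ≥0),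
      ∑ m ∈ Finset.range n, H m ω ≤ (t : ℝ≥0∞) →
      (t : ℝ≥0∞) < ∑ m ∈ Finset.range (n + 1), H m ω → J t ω = Y n ω)

/-- The σ-algebra generated by a process with discrete state space. -/
abbrev sigmaProcess (J : ℝ≥0 → Ω → I) : MeasurableSpace Ω :=
  ⨆ t, MeasurableSpace.comap (J t) ⊤

end JumpProcess

/-! ### Parameters -/

/-- `T` is the subintensity matrix of a Markov jump process on a finite set of transient states:
nonpositive diagonal, nonnegative off-diagonal entries, nonpositive row sums, and from every state
one can reach, through jumps of positive rate, a state with a positive exit rate `-(T 1) j`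
(for a finite state space this says that all the states are transient). -/
structure IsSubintensity {I : Type*} [Fintype I] (T : Matrix I I ℝ) : Prop where
  diag_nonpos : ∀ i, T i i ≤ 0
  off_diag_nonneg : ∀ i j, i ≠ j → 0 ≤ T i j
  row_sum_nonpos : ∀ i, ∑ j, T i j ≤ 0
  transient : ∀ i, ∃ j, Relation.ReflTransGen (fun a b => 0 < T a b) i j ∧ 0 < -∑ l, T j l

/-- Intensity matrix on `S ∪ {∂}` (with `∂ = none` absorbing) of the process with subintensity
matrix `Q` on `S`; absorption takes place at the rates `-Q 1`. -/
def withCemetery {S : Type*} [Fintype S] (Q : Matrix S S ℝ) : Matrix (Option S) (Option S) ℝ :=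
  fun x y =>
    match x, y with
    | some i, some j => Q i j
    | some i, none => -∑ j, Q i j
    | none, _ => 0

/-- Admissible parameters `(α, T, U, Q₁, Q₂)` of the common-shock model with pre-shock states `E`
and post-shock states `S`. -/
structure IsParam {E S : Type*} [Fintype E] [Fintype S] (α : E → ℝ) (T : Matrix E E ℝ)
    (U : Matrix E S ℝ) (Q₁ Q₂ : Matrix S S ℝ) : Prop where
  init_nonneg : ∀ i, 0 ≤ α i
  init_sum : ∑ i, α i = 1
  subintensity_T : IsSubintensity T
  shock_nonneg : ∀ i k, 0 ≤ U i k
  conservative : ∀ i, ∑ j, T i j + ∑ k, U i k = 0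
  subintensity_Q₁ : IsSubintensity Q₁
  subintensity_Q₂ : IsSubintensity Q₂

/-! ### The common-shock model -/

section Model

variable {E S Ω : Type*}

/-- The time of the common shock, `inf {t ≥ 0 : J₁₂(t) ∉ E}`. -/
def shockTime (J₁₂ : ℝ≥0 → Ω → E ⊕ S) (ω : Ω) : ℝ≥0 :=
  sInf {t : ℝ≥0 | ∀ e : E, J₁₂ t ω ≠ Sum.inl e}

/-- The time until absorption in `∂ = none` of a process `R` on `S ∪ {∂}`. -/
def absorptionTime (R : ℝ≥0 → Ω → Option S) (ω : Ω) : ℝ≥0 :=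
  sInf {t : ℝ≥0 | R t ω = none}

/-- The embedding of the state space `E ∪ S` of the joint process into the state space
`E ∪ S ∪ {∂}` of the two individual processes. -/
def embed : E ⊕ S → E ⊕ Option S := Sum.map id some

/-- The processes `J₁₂` (up to and including the shock), `J₁` and `J₂`, defined on the probability
space `(Ω, μ)`, form a common-shock model with parameters `(α, T, U, Q₁, Q₂)`; `K` is the state
entered at the shock, and `R₁`, `R₂` are the two processes after the shock, `Rᵢ(t) = Jᵢ(τ + t)`
with `τ` the shock time. -/
structure IsModel [Fintype E] [Fintype S] [MeasurableSpace Ω] (μ : Measure Ω)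
    (α : E → ℝ) (T : Matrix E E ℝ) (U : Matrix E S ℝ) (Q₁ Q₂ : Matrix S S ℝ)
    (J₁₂ : ℝ≥0 → Ω → E ⊕ S) (J₁ J₂ : ℝ≥0 → Ω → E ⊕ Option S) (K : Ω → S)
    (R₁ R₂ : ℝ≥0 → Ω → Option S) : Prop where
  /-- `J₁₂` starts in `E` from `α`, moves by `T` in `E` and by `U` from `E` to `S`, and is
  absorbed in `S`. -/
  joint : IsMarkovJumpProcess μ (Matrix.fromBlocks T U 0 0) (Sum.elim α 0) J₁₂
  /-- `K = J₁₂(τ)`, a state of `S`. -/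
  measurable_K : ∀ k, MeasurableSet {ω | K ω = k}
  shock_state : ∀ᵐ ω ∂μ, J₁₂ (shockTime J₁₂ ω) ω = Sum.inr (K ω)
  /-- `J₁` and `J₂` coincide with `J₁₂` up to and including the shock. -/
  pre_shock₁ : ∀ᵐ ω ∂μ, ∀ t ≤ shockTime J₁₂ ω, J₁ t ω = embed (J₁₂ t ω)
  pre_shock₂ : ∀ᵐ ω ∂μ, ∀ t ≤ shockTime J₁₂ ω, J₂ t ω = embed (J₁₂ t ω)
  /-- From the shock on, `J₁` and `J₂` live in `S ∪ {∂}`. -/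
  post_shock₁ : ∀ᵐ ω ∂μ, ∀ t, J₁ (shockTime J₁₂ ω + t) ω = Sum.inr (R₁ t ω)
  post_shock₂ : ∀ᵐ ω ∂μ, ∀ t, J₂ (shockTime J₁₂ ω + t) ω = Sum.inr (R₂ t ω)
  /-- Given `K = k`, the post-shock processes are Markov jump processes started in `k` and governed
  by `Q₁` and `Q₂` respectively. -/
  residual₁ : ∀ k, μ {ω | K ω = k} ≠ 0 →
    IsMarkovJumpProcess (cond μ {ω | K ω = k}) (withCemetery Q₁)
      (Set.indicator {some k} 1) R₁
  residual₂ : ∀ k, μ {ω | K ω = k} ≠ 0 →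
    IsMarkovJumpProcess (cond μ {ω | K ω = k}) (withCemetery Q₂)
      (Set.indicator {some k} 1) R₂
  /-- Given `K = k`, the post-shock processes are independent of each other and of the evolution
  up to the shock. -/
  indep : ∀ k, μ {ω | K ω = k} ≠ 0 →
    iIndep ![sigmaProcess J₁₂, sigmaProcess R₁, sigmaProcess R₂] (cond μ {ω | K ω = k})

end Model

/-- `ν` is the bivariate CSPH distribution with parameters `(α, T, U, Q₁, Q₂, a₁, a₂)`: the law
of `(X₁, X₂) = (a₁ τ + τ₁, a₂ τ + τ₂)` for a common-shock model with these parameters, where `τ` is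
the shock time and `τᵢ` the time spent by `Jᵢ` in `S` after the shock. -/
def HasCSPHLaw {E S : Type} [Fintype E] [Fintype S] (α : E → ℝ) (T : Matrix E E ℝ)
    (U : Matrix E S ℝ) (Q₁ Q₂ : Matrix S S ℝ) (a₁ a₂ : ℝ) (ν : Measure (ℝ × ℝ)) : Prop :=
  ∃ (Ω : Type) (_ : MeasurableSpace Ω) (μ : Measure Ω) (_ : IsProbabilityMeasure μ)
    (J₁₂ : ℝ≥0 → Ω → E ⊕ S) (J₁ J₂ : ℝ≥0 → Ω → E ⊕ Option S) (K : Ω → S)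
    (R₁ R₂ : ℝ≥0 → Ω → Option S),
    IsModel μ α T U Q₁ Q₂ J₁₂ J₁ J₂ K R₁ R₂ ∧
    HasLaw (fun ω => (a₁ * (shockTime J₁₂ ω : ℝ) + (absorptionTime R₁ ω : ℝ),
      a₂ * (shockTime J₁₂ ω : ℝ) + (absorptionTime R₂ ω : ℝ))) ν μ

/-- `ν` is a bivariate CSPH distribution with scaling factors `a₁` and `a₂`. -/
def IsCSPH (a₁ a₂ : ℝ) (ν : Measure (ℝ × ℝ)) : Prop :=
  ∃ (E S : Type) (_ : Fintype E) (_ : Fintype S) (α : E → ℝ) (T : Matrix E E ℝ)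
    (U : Matrix E S ℝ) (Q₁ Q₂ : Matrix S S ℝ),
    IsParam α T U Q₁ Q₂ ∧ HasCSPHLaw α T U Q₁ Q₂ a₁ a₂ ν

end CSPH

end

noncomputable section

namespace CSPH

/-! ### Standard exponential variables -/

/-! Draw `z` from `F` and round both coordinates to a grid of mesh `1 / (n + 1)`. The state entered
at the shock records the pair of cells, so it can carry all the dependence between the coordinates.
There is a single pre-shock state, left at rate `n + 1`, and block `b` is entered with probability
`F (κ ⁻¹' {b})`. Inside a block, process `i` runs through `n + 1` exponential stages whose total
mean is the `i`-th grid point. The law of large numbers concentrates this Erlang time at the grid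
point, while the shock time vanishes, and with it the effect of `a₁` and `a₂`.

All the models live on one space, `F` times three independent i.i.d. exponential sequences (shock,
first process, second process), so the response pairs converge almost surely to `z`
(`ae_tendsto_approx`), and weak convergence follows by dominated convergence. The other half is the
check that these explicit processes form an admissible model: `isParam` and `isModel`, resting on
`isMarkovJumpProcess_joint`, `isMarkovJumpProcess_residual` and `iIndep_processes`. -/

/-- The standard exponential distribution, as a measure on `ℝ≥0`. -/
def stdExp : Measure ℝ≥0 := (expMeasure 1).map Real.toNNReal

instance : IsProbabilityMeasure stdExp :=
  have := isProbabilityMeasure_expMeasure one_pos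
  Measure.isProbabilityMeasure_map (by fun_prop)

theorem stdExp_Ioi (s : ℝ≥0) : stdExp (Set.Ioi s) = ENNReal.ofReal (Real.exp (-s)) := by
  have := isProbabilityMeasure_expMeasure one_pos
  have h : Real.toNNReal ⁻¹' Set.Ioi s = (Set.Iic (s : ℝ))ᶜ := by
    ext x
    simp [Real.lt_toNNReal_iff_coe_lt]
  have hc := cdf_expMeasure_eq one_pos (s : ℝ)
  rw [cdf_eq_real] at hc
  rw [stdExp, Measure.map_apply (by fun_prop) measurableSet_Ioi, h,
    ← ofReal_measureReal, probReal_compl_eq_one_sub measurableSet_Iic, hc]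
  simp

theorem stdExp_lt_mul {c : ℝ≥0} (hc : 0 < c) (s : ℝ≥0) :
    stdExp {x | (s : ℝ≥0∞) < ((c * x : ℝ≥0) : ℝ≥0∞)} =
      ENNReal.ofReal (Real.exp (-(c : ℝ)⁻¹ * s)) := by
  have h : {x : ℝ≥0 | (s : ℝ≥0∞) < ((c * x : ℝ≥0) : ℝ≥0∞)} = Set.Ioi (s / c) := by
    ext x
    simp only [Set.mem_ofPred_eq, ENNReal.coe_lt_coe, Set.mem_Ioi, div_lt_iff₀ hc, mul_comm c]
  rw [h, stdExp_Ioi]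
  congr 2
  push_cast
  ring

theorem stdExp_pos : ∀ᵐ x ∂stdExp, 0 < x := by
  rw [ae_iff, ← prob_compl_eq_one_iff (by measurability)]
  have h : {x : ℝ≥0 | ¬ 0 < x}ᶜ = Set.Ioi 0 := by ext; simp
  rw [h, stdExp_Ioi]
  simp

theorem lintegral_stdExp : ∫⁻ x, ENNReal.ofReal (x : ℝ) ∂stdExp = 1 := by
  rw [lintegral_eq_lintegral_meas_lt _ (ae_of_all _ fun x => x.2) (by fun_prop)]
  have h : ∀ t ∈ Set.Ioi (0 : ℝ),
      stdExp {a : ℝ≥0 | t < a} = ENNReal.ofReal (Real.exp (-t)) := by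
    intro t ht
    lift t to ℝ≥0 using (Set.mem_Ioi.1 ht).le
    rw [← stdExp_Ioi]
    rfl
  rw [setLIntegral_congr_fun measurableSet_Ioi h, ← ofReal_integral_eq_lintegral_ofReal
    (by simpa [IntegrableOn] using exp_neg_integrableOn_Ioi 0 one_pos) (ae_of_all _ fun _ => (Real.exp_pos _).le),
    integral_exp_neg_Ioi_zero, ENNReal.ofReal_one]

theorem integrable_stdExp : Integrable (fun x : ℝ≥0 => (x : ℝ)) stdExp :=
  ⟨by fun_prop, by
    rw [hasFiniteIntegral_iff_ofReal (ae_of_all _ fun x => x.2), lintegral_stdExp]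
    exact ENNReal.one_lt_top⟩

theorem integral_stdExp : ∫ x, (x : ℝ) ∂stdExp = 1 := by
  rw [integral_eq_lintegral_of_nonneg_ae (ae_of_all _ fun x => x.2) (by fun_prop),
    lintegral_stdExp, ENNReal.toReal_one]

/-- The law of an i.i.d. sequence of standard exponential variables. -/
def expSeq : Measure (ℕ → ℝ≥0) := Measure.infinitePi fun _ => stdExp

instance : IsProbabilityMeasure expSeq := by unfold expSeq; infer_instance

/-- Rules out an empty first stage, so that a post-shock process really occupies its starting state
at time zero. -/
theorem expSeq_pos : ∀ᵐ x ∂expSeq, ∀ n, 0 < x n := by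
  rw [ae_all_iff]
  intro n
  exact (measurePreserving_eval_infinitePi (fun _ : ℕ => stdExp) n).quasiMeasurePreserving.ae
    stdExp_pos

theorem expSeq_tendsto :
    ∀ᵐ x ∂expSeq, Tendsto (fun n : ℕ => (∑ j ∈ Finset.range n, (x j : ℝ)) / n) atTop (𝓝 1) := by
  have hmp (n : ℕ) := measurePreserving_eval_infinitePi (fun _ : ℕ => stdExp) n
  have h := strong_law_ae_real (μ := expSeq) (fun (n : ℕ) (x : ℕ → ℝ≥0) => (x n : ℝ))
    ((hmp 0).integrable_comp_of_integrable integrable_stdExp)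
    (fun i j hij => (iIndepFun_infinitePi (P := fun _ : ℕ => stdExp)
      (X := fun _ (x : ℝ≥0) => (x : ℝ)) (fun _ => by fun_prop)).indepFun hij)
    (fun i => by
      refine ⟨Measurable.aemeasurable (by fun_prop), Measurable.aemeasurable (by fun_prop), ?_⟩
      have key (n : ℕ) : expSeq.map (fun x => ((x n : ℝ≥0) : ℝ)) =
          stdExp.map (fun x : ℝ≥0 => (x : ℝ)) := by
        rw [← (hmp n).map_eq, Measure.map_map (by fun_prop) (by fun_prop)]
        rfl
      rw [key, key])
  have h1 : ∫ x, ((x 0 : ℝ≥0) : ℝ) ∂expSeq = 1 := by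
    rw [← integral_stdExp, ← (hmp 0).map_eq, integral_map (hmp 0).measurable.aemeasurable (by fun_prop)]
    rfl
  simpa only [h1] using h

/-- The law of three independent i.i.d. sequences of standard exponential variables. -/
def expSeqs : Measure (Fin 3 → ℕ → ℝ≥0) := Measure.pi fun _ => expSeq

instance : IsProbabilityMeasure expSeqs := by unfold expSeqs; infer_instance

theorem measurePreserving_expSeqs (i : Fin 3) :
    MeasurePreserving (fun x : Fin 3 → ℕ → ℝ≥0 => x i) expSeqs expSeq :=
  measurePreserving_eval (fun _ => expSeq) i

section Product

variable {A : Type*} [MeasurableSpace A] (ν : Measure A) [IsProbabilityMeasure ν]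

theorem measurePreserving_noise (i : Fin 3) :
    MeasurePreserving (fun ω : A × (Fin 3 → ℕ → ℝ≥0) => ω.2 i) (ν.prod expSeqs) expSeq :=
  (measurePreserving_expSeqs i).comp measurePreserving_snd

theorem iIndepFun_noise :
    iIndepFun (fun (i : Fin 3) (ω : A × (Fin 3 → ℕ → ℝ≥0)) => ω.2 i) (ν.prod expSeqs) := by
  rw [iIndepFun_iff_map_fun_eq_pi_map (fun i => by fun_prop)]
  simp only [(measurePreserving_noise ν _).map_eq]
  exact (measurePreserving_snd (μ := ν) (ν := expSeqs)).map_eq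

/-- An event about the first factor alone leaves the noise untouched; conditioning on the shock
state thus only replaces `F` by a conditioned measure. -/
theorem cond_prod_univ (s : Set A) :
    cond (ν.prod expSeqs) (s ×ˢ Set.univ) = (cond ν s).prod expSeqs := by
  rw [ProbabilityTheory.cond, ProbabilityTheory.cond, Measure.prod_smul_left, Measure.prod_prod, measure_univ, mul_one,
    ← Measure.restrict_univ (μ := expSeqs), Measure.prod_restrict]
  simp

end Product

/-! ### Coxian chains -/

variable {B : Type*}

/-- The sequence of states visited from `(b, 0)`: the `d + 1` stages of the block `b`, then the
cemetery. -/
def path (d : ℕ) (b : B) (n : ℕ) : Option (B × Fin (d + 1)) :=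
  if h : n < d + 1 then some (b, ⟨n, h⟩) else none

/-- The subintensity matrix of the chain that runs through the stages of the block `b` with mean
holding time `c b` in each. -/
def erlang [DecidableEq B] (d : ℕ) (c : B → ℝ≥0) : Matrix (B × Fin (d + 1)) (B × Fin (d + 1)) ℝ :=
  fun x y => if x = y then -(c x.1 : ℝ)⁻¹
    else if path d x.1 (x.2 + 1) = some y then (c x.1 : ℝ)⁻¹ else 0

theorem path_of_lt {d n : ℕ} (b : B) (h : n < d + 1) : path d b n = some (b, ⟨n, h⟩) := dif_pos h

theorem path_of_le {d n : ℕ} (b : B) (h : d + 1 ≤ n) : path d b n = none := dif_neg (by lia)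

/-- Makes the two nonzero cases of `erlang` disjoint, so that its row sums split. -/
theorem path_succ_ne_some (d : ℕ) (x : B × Fin (d + 1)) : path d x.1 (x.2 + 1) ≠ some x := by
  unfold path
  split_ifs with h
  · intro h'
    have := congrArg (fun z : B × Fin (d + 1) => (z.2 : ℕ)) (Option.some.inj h')
    simp at this
  · simp

section Erlang

variable [DecidableEq B] {d : ℕ} {c : B → ℝ≥0}

theorem erlang_self (x : B × Fin (d + 1)) : erlang d c x x = -(c x.1 : ℝ)⁻¹ := by simp [erlang]

theorem erlang_of_ne {x y : B × Fin (d + 1)} (h : x ≠ y) :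
    erlang d c x y = if path d x.1 (x.2 + 1) = some y then (c x.1 : ℝ)⁻¹ else 0 := by
  simp [erlang, h]

theorem sum_erlang [Fintype B] (x : B × Fin (d + 1)) :
    ∑ y, erlang d c x y = if path d x.1 (x.2 + 1) = none then -(c x.1 : ℝ)⁻¹ else 0 := by
  have h : ∀ y, erlang d c x y = (if x = y then -(c x.1 : ℝ)⁻¹ else 0) +
      if path d x.1 (x.2 + 1) = some y then (c x.1 : ℝ)⁻¹ else 0 := by
    intro y
    by_cases hxy : x = y
    · subst hxy
      simp [erlang, path_succ_ne_some]
    · simp [erlang, hxy]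
  simp_rw [h, Finset.sum_add_distrib]
  cases hp : path d x.1 (x.2 + 1) with
  | none => simp
  | some z => simp

theorem isSubintensity_erlang [Fintype B] (hc : ∀ b, 0 < c b) : IsSubintensity (erlang d c) where
  diag_nonpos x := by simp [erlang_self]
  off_diag_nonneg x y h := by
    rw [erlang_of_ne h]
    split_ifs <;> simp
  row_sum_nonpos x := by
    rw [sum_erlang]
    split_ifs <;> simp
  transient := by
    rintro ⟨b, j⟩
    refine ⟨(b, Fin.last d), ?_, ?_⟩
    -- Only the last stage has a positive exit rate; every other stage steps towards it.
    · induction j using Fin.reverseInduction with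
      | last => exact .refl
      | cast j ih =>
        refine .head ?_ ih
        rw [erlang_of_ne (by simp [Prod.ext_iff, Fin.ext_iff]), if_pos]
        · simpa using hc b
        · simp [path, Fin.ext_iff]
    · rw [sum_erlang, if_pos (path_of_le _ (by simp))]
      simpa using hc b

/-- The only randomness of the chain is in its holding times: the jump chain follows `path`
deterministically and stays in the cemetery. -/
theorem jumpMatrix_erlang [Fintype B] (hc : ∀ b, 0 < c b) (b : B) (n : ℕ)
    (y : Option (B × Fin (d + 1))) :
    jumpMatrix (withCemetery (erlang d c)) (path d b n) y =
      if path d b (n + 1) = y then 1 else 0 := by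
  have hb : (c b : ℝ) ≠ 0 := by exact_mod_cast (hc b).ne'
  rcases lt_or_ge n (d + 1) with h | h
  · have hself : withCemetery (erlang d c) (path d b n) (path d b n) = -(c b : ℝ)⁻¹ := by
      rw [path_of_lt b h]
      exact erlang_self _
    rw [jumpMatrix, if_neg (by simp [hself, hb]), hself]
    rw [path_of_lt b h]
    cases y with
    | none =>
      have := sum_erlang (c := c) (b, (⟨n, h⟩ : Fin (d + 1)))
      simp only [withCemetery, this]
      by_cases hp : path d b (n + 1) = none
      · simp [hp, hb]
      · simp [hp]
    | some z =>
      by_cases hz : (b, (⟨n, h⟩ : Fin (d + 1))) = z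
      · subst hz
        simpa using path_succ_ne_some d (b, (⟨n, h⟩ : Fin (d + 1)))
      · have := erlang_of_ne (c := c) hz
        simp only [withCemetery, this, Option.some.injEq, hz, if_false]
        split_ifs <;> simp [hb]
  · rw [path_of_le b h, path_of_le b (by lia)]
    simp [jumpMatrix, withCemetery, eq_comm]

end Erlang

/-! ### Post-shock processes -/

/-- The number of completed stages at time `t`, when the stages have lengths `c * x n`, `n ≤ d`. -/
def stage (d : ℕ) (c : ℝ≥0) (x : ℕ → ℝ≥0) (t : ℝ≥0) : ℕ :=
  ((Finset.range (d + 1)).filter fun n => c * ∑ j ∈ Finset.range (n + 1), x j ≤ t).card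

/-- The holding times in the states `path d b n`. -/
def holding (d : ℕ) (c : ℝ≥0) (x : ℕ → ℝ≥0) (n : ℕ) : ℝ≥0∞ :=
  if n < d + 1 then ((c * x n : ℝ≥0) : ℝ≥0∞) else ∞

section Stage

variable {d : ℕ} {c : ℝ≥0} {x : ℕ → ℝ≥0} {t : ℝ≥0}

theorem sum_holding {n : ℕ} (h : n ≤ d + 1) :
    ∑ m ∈ Finset.range n, holding d c x m = ((c * ∑ j ∈ Finset.range n, x j : ℝ≥0) : ℝ≥0∞) := by
  rw [Finset.mul_sum, ENNReal.ofNNReal_finsetSum]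
  refine Finset.sum_congr rfl fun m hm => if_pos ?_
  have := Finset.mem_range.1 hm
  lia

theorem mul_sum_mono : Monotone fun n => c * ∑ j ∈ Finset.range n, x j := fun _ _ h =>
  mul_le_mul_right (Finset.sum_le_sum_of_subset (Finset.range_mono h)) c

/-- Partial sums are monotone, so the completed stages form an initial segment. The upper bound is
asked only for `n < d + 1`, which lets `n = d + 1` cover the absorbed state. -/
theorem stage_eq {n : ℕ} (hn : n ≤ d + 1) (h₁ : c * ∑ j ∈ Finset.range n, x j ≤ t)
    (h₂ : n < d + 1 → t < c * ∑ j ∈ Finset.range (n + 1), x j) : stage d c x t = n := by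
  rw [stage, ← Finset.card_range n]
  congr 1
  ext m
  simp only [Finset.mem_filter, Finset.mem_range]
  refine ⟨fun ⟨hm, hmt⟩ => ?_, fun hm => ⟨by lia, le_trans (mul_sum_mono (by lia)) h₁⟩⟩
  by_contra hnm
  exact absurd (hmt.trans_lt (h₂ (by lia)))
    (mul_sum_mono (c := c) (x := x) (show n + 1 ≤ m + 1 by lia)).not_gt

theorem stage_eq_of_holding {n : ℕ} (h₁ : ∑ m ∈ Finset.range n, holding d c x m ≤ t)
    (h₂ : (t : ℝ≥0∞) < ∑ m ∈ Finset.range (n + 1), holding d c x m) : stage d c x t = n := by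
  have hn : n ≤ d + 1 := by
    -- Beyond `d + 1`, the sum would contain the infinite holding time in the cemetery.
    by_contra! h
    have : holding d c x (d + 1) ≤ ∑ m ∈ Finset.range n, holding d c x m :=
      Finset.single_le_sum (fun _ _ => zero_le) (Finset.mem_range.2 h)
    rw [holding, if_neg (lt_irrefl _)] at this
    exact absurd (this.trans h₁) (by simp)
  refine stage_eq hn ?_ fun h => ?_
  · rwa [sum_holding hn, ENNReal.coe_le_coe] at h₁
  · rwa [sum_holding h, ENNReal.coe_lt_coe] at h₂

theorem le_stage_iff : d + 1 ≤ stage d c x t ↔ c * ∑ j ∈ Finset.range (d + 1), x j ≤ t := by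
  refine ⟨fun h => ?_, fun h => (stage_eq le_rfl h (by simp)).ge⟩
  -- Full cardinality means that no index was filtered out, in particular not the last one.
  have hs := Finset.eq_of_subset_of_card_le (Finset.filter_subset
    (fun n => c * ∑ j ∈ Finset.range (n + 1), x j ≤ t) (Finset.range (d + 1))) ((Finset.card_range _).trans_le h)
  have := hs.symm ▸ Finset.self_mem_range_succ d
  exact (Finset.mem_filter.1 this).2

theorem stage_zero (hc : 0 < c) (hx : 0 < x 0) : stage d c x 0 = 0 :=
  stage_eq (by simp) (by simp) fun _ => by simpa using ⟨hc, hx⟩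

end Stage

theorem path_zero {B : Type*} (d : ℕ) (b : B) : path d b 0 = some (b, 0) := path_of_lt b (by lia)

section Holding

variable {B : Type*} [Fintype B] [DecidableEq B] {d : ℕ} {c : B → ℝ≥0}

theorem withCemetery_path (b : B) (n : ℕ) :
    withCemetery (erlang d c) (path d b n) (path d b n) =
      if n < d + 1 then -(c b : ℝ)⁻¹ else 0 := by
  split_ifs with h
  · rw [path_of_lt b h]
    exact erlang_self _
  · rw [path_of_le b (by lia)]
    rfl

/-- The `m`-th holding time depends on `x m` only, hence the constant sequence. In the cemetery the
rate is zero and the time infinite, and both sides are one. -/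
theorem stdExp_holding (hc : ∀ b, 0 < c b) (b : B) (s : ℝ≥0) (m : ℕ) :
    stdExp {x | (s : ℝ≥0∞) < holding d (c b) (fun _ => x) m} =
      ENNReal.ofReal (Real.exp
        (withCemetery (erlang d c) (path d b m) (path d b m) * (s : ℝ))) := by
  rw [withCemetery_path]
  unfold holding
  split_ifs with h
  · exact stdExp_lt_mul (hc b) s
  · simp

theorem expSeq_holding (hc : ∀ b, 0 < c b) (b : B) (s : ℕ → ℝ≥0) (n : ℕ) :
    expSeq {x | ∀ m ≤ n, (s m : ℝ≥0∞) < holding d (c b) x m} =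
      ENNReal.ofReal (∏ m ∈ Finset.range (n + 1), Real.exp
        (withCemetery (erlang d c) (path d b m) (path d b m) * (s m : ℝ))) := by
  have h : {x | ∀ m ≤ n, (s m : ℝ≥0∞) < holding d (c b) x m} =
      Set.pi (Finset.range (n + 1))
        fun m => {x | (s m : ℝ≥0∞) < holding d (c b) (fun _ => x) m} := by
    ext x
    simp [Set.mem_pi, holding]
  rw [h, expSeq, Measure.infinitePi_pi, ENNReal.ofReal_prod_of_nonneg fun _ _ => (Real.exp_pos _).le]
  · exact Finset.prod_congr rfl fun m _ => stdExp_holding hc b (s m) m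
  · intro m _
    refine measurableSet_lt measurable_const ?_
    unfold holding
    split_ifs <;> fun_prop

end Holding

section Residual

variable {A B : Type*}

/-- The post-shock process: with `c` the mean holding time in a stage, the `i`-th noise sequence
drives the process through the stages of the block `κ ω.1`. -/
def residual (d : ℕ) (c : B → ℝ≥0) (κ : A → B) (i : Fin 3) (t : ℝ≥0)
    (ω : A × (Fin 3 → ℕ → ℝ≥0)) : Option (B × Fin (d + 1)) :=
  path d (κ ω.1) (stage d (c (κ ω.1)) (ω.2 i) t)

variable {d : ℕ} {c : B → ℝ≥0} {κ : A → B}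

theorem absorptionTime_residual (i : Fin 3) (ω : A × (Fin 3 → ℕ → ℝ≥0)) :
    absorptionTime (residual d c κ i) ω =
      c (κ ω.1) * ∑ j ∈ Finset.range (d + 1), ω.2 i j := by
  have h : {t : ℝ≥0 | residual d c κ i t ω = none} =
      Set.Ici (c (κ ω.1) * ∑ j ∈ Finset.range (d + 1), ω.2 i j) := by
    ext t
    rw [Set.mem_Ici, ← le_stage_iff]
    simp [residual, path]
  rw [absorptionTime, h, csInf_Ici]

variable [MeasurableSpace B] [DiscreteMeasurableSpace B]

theorem measurable_stage (d : ℕ) (c : B → ℝ≥0) (t : ℝ≥0) :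
    Measurable fun z : B × (ℕ → ℝ≥0) => stage d (c z.1) z.2 t := by
  simp only [stage, Finset.card_filter]
  have hc : Measurable c := .of_discrete
  refine Finset.measurable_fun_sum _ fun n _ => Measurable.ite ?_ measurable_const measurable_const
  exact measurableSet_le (by fun_prop) measurable_const

variable [Countable B]

/-- The process is a function of the block and of its own noise sequence; independence is inherited
from the noise through this inclusion. -/
theorem sigmaProcess_residual_le (d : ℕ) (c : B → ℝ≥0) (κ : A → B) (i : Fin 3) :
    sigmaProcess (residual d c κ i) ≤
      MeasurableSpace.comap (fun ω : A × (Fin 3 → ℕ → ℝ≥0) => (κ ω.1, ω.2 i)) inferInstance := by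
  refine iSup_le fun t => ?_
  rintro _ ⟨s, -, rfl⟩
  refine ⟨{z : B × (ℕ → ℝ≥0) | path d z.1 (stage d (c z.1) z.2 t) ∈ s}, ?_, rfl⟩
  have h : Measurable fun z : B × (ℕ → ℝ≥0) => (z.1, stage d (c z.1) z.2 t) :=
    measurable_fst.prodMk (measurable_stage d c t)
  exact h (MeasurableSet.of_discrete (s := {p : B × ℕ | path d p.1 p.2 ∈ s}))

variable [MeasurableSpace A]

theorem measurableSet_residual (hκ : Measurable κ) (i : Fin 3) (t : ℝ≥0)
    (s : Set (Option (B × Fin (d + 1)))) : MeasurableSet (residual d c κ i t ⁻¹' s) := by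
  have hm : Measurable fun ω : A × (Fin 3 → ℕ → ℝ≥0) => (κ ω.1, ω.2 i) := by fun_prop
  exact hm.comap_le _ (sigmaProcess_residual_le d c κ i _
    (le_iSup (fun t => MeasurableSpace.comap (residual d c κ i t) ⊤) t _ ⟨s, trivial, rfl⟩))

theorem isMarkovJumpProcess_residual [Fintype B] [DecidableEq B] (hc : ∀ b, 0 < c b) (hκ : Measurable κ)
    (ν : Measure A) [IsProbabilityMeasure ν] {b : B} (hb : ∀ᵐ z ∂ν, κ z = b) (i : Fin 3) :
    IsMarkovJumpProcess (ν.prod expSeqs) (withCemetery (erlang d c))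
      (Set.indicator {some (b, 0)} 1) (residual d c κ i) := by
  refine ⟨fun t j => measurableSet_residual hκ i t {j},
    fun n ω => path d (κ ω.1) n, fun n ω => holding d (c (κ ω.1)) (ω.2 i) n, ?_, ?_, ?_, ?_⟩
  · intro n j
    exact (hκ.comp measurable_fst) (MeasurableSet.of_discrete (s := {b | path d b n = j}))
  · intro n
    have hcm : Measurable c := .of_discrete
    simp only [holding]
    split_ifs <;> fun_prop
  · intro n j s
    have hb' : ∀ᵐ ω ∂(ν.prod expSeqs), κ ω.1 = b :=
      (measurePreserving_fst (μ := ν) (ν := expSeqs)).quasiMeasurePreserving.ae hb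
    -- Along the path all transition probabilities are one and only the holding times matter; off
    -- the path both sides vanish.
    by_cases hj : ∀ m ≤ n, path d b m = j m
    · have hset : {ω : A × (Fin 3 → ℕ → ℝ≥0) | ∀ m ≤ n, path d (κ ω.1) m = j m ∧
          (s m : ℝ≥0∞) < holding d (c (κ ω.1)) (ω.2 i) m} =ᵐ[ν.prod expSeqs]
          (fun ω => ω.2 i) ⁻¹' {x | ∀ m ≤ n, (s m : ℝ≥0∞) < holding d (c b) x m} := by
        filter_upwards [hb'] with ω hω
        refine propext ⟨fun h m hm => ?_, fun h m hm => ⟨?_, ?_⟩⟩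
        · exact hω ▸ (h m hm).2
        · rw [hω]; exact hj m hm
        · rw [hω]; exact h m hm
      have hms : MeasurableSet {x | ∀ m ≤ n, (s m : ℝ≥0∞) < holding d (c b) x m} := by
        simp only [Set.ofPred_forall]
        refine .iInter fun m => .iInter fun _ => measurableSet_lt measurable_const ?_
        unfold holding
        split_ifs <;> fun_prop
      have hone : ∏ m ∈ Finset.range n,
          jumpMatrix (withCemetery (erlang d c)) (j m) (j (m + 1)) = 1 := by
        refine Finset.prod_eq_one fun m hm => ?_
        have := Finset.mem_range.1 hm
        rw [← hj m (by lia), ← hj (m + 1) (by lia), jumpMatrix_erlang hc, if_pos rfl]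
      rw [measure_congr hset, (measurePreserving_noise ν i).measure_preimage hms.nullMeasurableSet,
        expSeq_holding hc, ← hj 0 (zero_le), path_zero, Set.indicator_of_mem (Set.mem_singleton _),
        Pi.one_apply, one_mul, hone, one_mul]
      congr 1
      refine Finset.prod_congr rfl fun m hm => ?_
      rw [hj m (by have := Finset.mem_range.1 hm; lia)]
    · have hzero : (Set.indicator {some (b, 0)} 1 (j 0) : ℝ) *
          ∏ m ∈ Finset.range n, jumpMatrix (withCemetery (erlang d c)) (j m) (j (m + 1)) = 0 := by
        by_contra hne
        obtain ⟨h0, hprod⟩ := mul_ne_zero_iff.1 hne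
        rw [Finset.prod_ne_zero_iff] at hprod
        -- Nonzero factors force `j` to start at `(b, 0)` and to follow the path step by step.
        refine hj fun m hm => ?_
        induction m with
        | zero => rw [path_zero]; exact (Set.mem_of_indicator_ne_zero h0).symm
        | succ m ih =>
          have := hprod m (Finset.mem_range.2 (by lia))
          rw [← ih (by lia), jumpMatrix_erlang hc] at this
          by_contra hcon
          exact this (if_neg hcon)
      rw [hzero, zero_mul, ENNReal.ofReal_zero]
      refine measure_mono_null (t := {ω | ¬ κ ω.1 = b}) (fun ω hω hωb => hj fun m hm => ?_) hb'
      rw [← hωb]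
      exact (hω m hm).1
  · refine ae_of_all _ fun ω n t h₁ h₂ => ?_
    rw [residual, stage_eq_of_holding h₁ h₂]

end Residual

/-! ### The process up to the shock -/

section Joint

variable {A B : Type*} {d : ℕ}

/-- The process up to the shock, which takes place at time `θ * ω.2 0 0` and leads to the first
stage of the block `κ ω.1`. -/
def joint (d : ℕ) (θ : ℝ≥0) (κ : A → B) (t : ℝ≥0) (ω : A × (Fin 3 → ℕ → ℝ≥0)) :
    Unit ⊕ (B × Fin (d + 1)) :=
  if t < θ * ω.2 0 0 then Sum.inl () else Sum.inr (κ ω.1, 0)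

theorem shockTime_joint (θ : ℝ≥0) (κ : A → B) (ω : A × (Fin 3 → ℕ → ℝ≥0)) :
    shockTime (joint d θ κ) ω = θ * ω.2 0 0 := by
  have h : {t : ℝ≥0 | ∀ e : Unit, joint d θ κ t ω ≠ Sum.inl e} = Set.Ici (θ * ω.2 0 0) := by
    ext t
    by_cases ht : t < θ * ω.2 0 0
    · simp [joint]
    · simp [joint, not_lt.1 ht]
  rw [shockTime, h, csInf_Ici]

theorem sigmaProcess_joint_le [MeasurableSpace B] [DiscreteMeasurableSpace B]
    (θ : ℝ≥0) (κ : A → B) :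
    sigmaProcess (joint d θ κ) ≤
      MeasurableSpace.comap (fun ω : A × (Fin 3 → ℕ → ℝ≥0) => (κ ω.1, ω.2 0)) inferInstance := by
  refine iSup_le fun t => ?_
  rintro _ ⟨s, -, rfl⟩
  refine ⟨{z : B × (ℕ → ℝ≥0) | (if t < θ * z.2 0 then Sum.inl () else Sum.inr (z.1, 0)) ∈ s},
    ?_, rfl⟩
  have h₁ : MeasurableSet {z : B × (ℕ → ℝ≥0) | t < θ * z.2 0} :=
    measurableSet_lt measurable_const (by fun_prop)
  have h₂ : MeasurableSet {z : B × (ℕ → ℝ≥0) | Sum.inr (z.1, 0) ∈ s} :=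
    measurable_fst (MeasurableSet.of_discrete (s := {b : B | Sum.inr (b, 0) ∈ s}))
  convert (h₁.inter (.const (Sum.inl () ∈ s))).union (h₁.compl.inter h₂) using 1
  ext z
  by_cases hz : t < θ * z.2 0 <;> simp [hz]

variable [MeasurableSpace A]

/-- The rates of the shock. -/
def shockRate (d : ℕ) (θ : ℝ≥0) (κ : A → B) (F : Measure A) : Matrix Unit (B × Fin (d + 1)) ℝ :=
  fun _ k => if k.2 = 0 then (θ : ℝ)⁻¹ * F.real (κ ⁻¹' {k.1}) else 0

theorem measure_shock {θ : ℝ≥0} (hθ : 0 < θ) (κ : A → B) (F : Measure A)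
    [IsProbabilityMeasure F] (s : Set B) (u : ℝ≥0) :
    (F.prod expSeqs) {ω | κ ω.1 ∈ s ∧ (u : ℝ≥0∞) < ((θ * ω.2 0 0 : ℝ≥0) : ℝ≥0∞)} =
      F (κ ⁻¹' s) * ENNReal.ofReal (Real.exp (-(θ : ℝ)⁻¹ * u)) := by
  have h : {ω : A × (Fin 3 → ℕ → ℝ≥0) |
      κ ω.1 ∈ s ∧ (u : ℝ≥0∞) < ((θ * ω.2 0 0 : ℝ≥0) : ℝ≥0∞)} =
      (κ ⁻¹' s) ×ˢ ((fun x : Fin 3 → ℕ → ℝ≥0 => x 0 0) ⁻¹'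
        {x | (u : ℝ≥0∞) < ((θ * x : ℝ≥0) : ℝ≥0∞)}) := rfl
  have hmp : MeasurePreserving (fun x : Fin 3 → ℕ → ℝ≥0 => x 0 0) expSeqs stdExp :=
    (measurePreserving_eval_infinitePi (fun _ : ℕ => stdExp) 0).comp (measurePreserving_expSeqs 0)
  rw [h, Measure.prod_prod, hmp.measure_preimage, stdExp_lt_mul hθ]
  exact (measurableSet_lt measurable_const (by fun_prop)).nullMeasurableSet

variable [MeasurableSpace B] [DiscreteMeasurableSpace B]

/-- The fibres of `κ` partition the space, so the shock rates add up to the exit rate of the single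
pre-shock state. -/
theorem sum_shockRate [Fintype B] (θ : ℝ≥0) {κ : A → B} (hκ : Measurable κ) (F : Measure A)
    [IsProbabilityMeasure F] (e : Unit) : ∑ k, shockRate d θ κ F e k = (θ : ℝ)⁻¹ := by
  have h := sum_measureReal_preimage_singleton (μ := F) (Finset.univ : Finset B) (f := κ)
    fun b _ => hκ .of_discrete
  simp [shockRate, Fintype.sum_prod_type, ← Finset.mul_sum, h]

theorem isParam [Fintype B] [DecidableEq B] {θ : ℝ≥0} (hθ : 0 < θ) {κ : A → B} (hκ : Measurable κ)
    (F : Measure A) [IsProbabilityMeasure F] {c₁ c₂ : B → ℝ≥0} (hc₁ : ∀ b, 0 < c₁ b)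
    (hc₂ : ∀ b, 0 < c₂ b) :
    IsParam (fun _ : Unit => 1) (fun _ _ => -(θ : ℝ)⁻¹) (shockRate d θ κ F) (erlang d c₁)
      (erlang d c₂) where
  init_nonneg _ := zero_le_one
  init_sum := by simp
  subintensity_T :=
    { diag_nonpos := fun _ => by simp
      off_diag_nonneg := fun i j h => absurd (Subsingleton.elim i j) h
      row_sum_nonpos := fun _ => by simp
      transient := fun i => ⟨i, .refl, by simpa using hθ⟩ }
  shock_nonneg _ _ := by
    unfold shockRate
    split_ifs <;> positivity
  conservative e := by rw [sum_shockRate θ hκ]; simp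
  subintensity_Q₁ := isSubintensity_erlang hc₁
  subintensity_Q₂ := isSubintensity_erlang hc₂

theorem isMarkovJumpProcess_joint {θ : ℝ≥0} (hθ : 0 < θ) {κ : A → B} (hκ : Measurable κ)
    (F : Measure A) [IsProbabilityMeasure F] :
    IsMarkovJumpProcess (F.prod expSeqs)
      (Matrix.fromBlocks (fun _ _ => -(θ : ℝ)⁻¹) (shockRate d θ κ F) 0 0)
      (Sum.elim (fun _ : Unit => (1 : ℝ)) 0) (joint d θ κ) := by
  classical
  have hθ' : (θ : ℝ) ≠ 0 := by exact_mod_cast hθ.ne'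
  have hm : Measurable fun ω : A × (Fin 3 → ℕ → ℝ≥0) => (κ ω.1, ω.2 0) := by fun_prop
  set Q := Matrix.fromBlocks (fun _ _ : Unit => -(θ : ℝ)⁻¹) (shockRate d θ κ F) 0 0 with hQ
  have hQl : ∀ e : Unit, Q (Sum.inl e) (Sum.inl e) = -(θ : ℝ)⁻¹ := fun _ => rfl
  have hQr : ∀ k k' : B × Fin (d + 1), Q (Sum.inr k) (Sum.inr k') = 0 := fun _ _ => rfl
  have hjl : ∀ e e' : Unit, jumpMatrix Q (Sum.inl e) (Sum.inl e') = 0 := fun e e' => by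
    simp [jumpMatrix, hQl, hθ']
  have hjlr : ∀ (e : Unit) k, jumpMatrix Q (Sum.inl e) (Sum.inr k) =
      if k.2 = 0 then F.real (κ ⁻¹' {k.1}) else 0 := fun e k => by
    have : Q (Sum.inl e) (Sum.inr k) = shockRate d θ κ F e k := rfl
    rw [jumpMatrix, if_neg (by simpa [hQl] using hθ.ne'), if_neg (by simp), this, hQl, neg_neg,
      shockRate]
    split_ifs
    · field_simp
    · simp
  have hjr : ∀ k y, jumpMatrix Q (Sum.inr k) y = if Sum.inr k = y then 1 else 0 := fun k y => by
    simp [jumpMatrix, hQr]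
  refine ⟨fun t i => ?_,
    fun n ω => if n = 0 then Sum.inl () else Sum.inr (κ ω.1, 0),
    fun n ω => if n = 0 then ((θ * ω.2 0 0 : ℝ≥0) : ℝ≥0∞) else ∞, ?_, ?_, ?_, ?_⟩
  · exact hm.comap_le _ (sigmaProcess_joint_le θ κ _
      (le_iSup (fun t => MeasurableSpace.comap (joint d θ κ t) ⊤) t _ ⟨{i}, trivial, rfl⟩))
  · intro n i
    by_cases hn : n = 0
    · simp [hn]
    · simp only [hn, if_false]
      exact (hκ.comp measurable_fst) (MeasurableSet.of_discrete (s := {b | Sum.inr (b, 0) = i}))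
  · intro n
    dsimp only
    split_ifs <;> fun_prop
  · intro n i s
    rcases hi0 : i 0 with e | k
    swap
    · simp only [Sum.elim_inr, Pi.zero_apply, zero_mul, ENNReal.ofReal_zero]
      convert measure_empty (μ := F.prod expSeqs)
      ext ω
      simp only [Set.mem_ofPred_eq, Set.mem_empty_iff_false, iff_false]
      intro h
      simpa [hi0] using (h 0 (Nat.zero_le _)).1
    rw [Sum.elim_inl, one_mul]
    rcases n with - | n
    · have h := measure_shock hθ κ F Set.univ (s 0)
      simp only [Set.mem_univ, true_and, Set.preimage_univ, measure_univ, one_mul] at h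
      simpa [hi0, hQl] using h
    -- The first jump is split off: it is the only random one, since the chain is frozen afterwards.
    rw [Finset.prod_range_succ' (fun m => jumpMatrix Q (i m) (i (m + 1)))]
    -- After the jump the states must all equal one `(b, 0)`; any other sequence has probability
    -- zero on both sides.
    by_cases hgood : ∃ b, ∀ m ≤ n, i (m + 1) = Sum.inr (b, 0)
    · obtain ⟨b, hb⟩ := hgood
      have hone : ∏ m ∈ Finset.range n, jumpMatrix Q (i (m + 1)) (i (m + 1 + 1)) = 1 :=
        Finset.prod_eq_one fun m hm => by
          have := Finset.mem_range.1 hm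
          rw [hb m (by lia), hb (m + 1) (by lia), hjr, if_pos rfl]
      have hone' : ∏ m ∈ Finset.range (n + 1),
          Real.exp (Q (i (m + 1)) (i (m + 1)) * (s (m + 1) : ℝ)) = 1 :=
        Finset.prod_eq_one fun m hm => by
          have := Finset.mem_range.1 hm
          rw [hb m (by lia), hQr, zero_mul, Real.exp_zero]
      rw [Finset.prod_range_succ', hone, hone', hi0, hb 0 (Nat.zero_le _), hjlr, if_pos rfl, hQl,
        one_mul, one_mul, ENNReal.ofReal_mul measureReal_nonneg, ofReal_measureReal,
        ← measure_shock hθ κ F {b} (s 0)]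
      congr 1
      ext ω
      simp only [Set.mem_ofPred_eq, Set.mem_singleton_iff]
      refine ⟨fun h => ⟨?_, by simpa using (h 0 (Nat.zero_le _)).2⟩, fun h m hm => ?_⟩
      · have := (h 1 (by lia)).1
        rw [hb 0 (Nat.zero_le _)] at this
        simpa using this
      · rcases m with - | m
        · simpa [hi0] using h.2
        · simp [hb m (by lia), h.1]
    · have hzero : (∏ m ∈ Finset.range n, jumpMatrix Q (i (m + 1)) (i (m + 1 + 1))) *
          jumpMatrix Q (i 0) (i (0 + 1)) = 0 := by
        by_contra hne
        obtain ⟨hprod, h0⟩ := mul_ne_zero_iff.1 hne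
        rw [Finset.prod_ne_zero_iff] at hprod
        rcases hi1 : i (0 + 1) with e' | k
        · rw [hi0, hi1, hjl] at h0
          exact h0 rfl
        rw [hi0, hi1, hjlr] at h0
        have hk : k.2 = 0 := by
          by_contra hk
          exact h0 (if_neg hk)
        refine hgood ⟨k.1, fun m hm => ?_⟩
        induction m with
        | zero => rw [hi1, ← hk]
        | succ m ih =>
          have := hprod m (Finset.mem_range.2 (by lia))
          rw [ih (by lia), hjr] at this
          by_contra hcon
          exact this (if_neg (Ne.symm hcon))
      rw [hzero, zero_mul, ENNReal.ofReal_zero]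
      convert measure_empty (μ := F.prod expSeqs)
      ext ω
      simp only [Set.mem_ofPred_eq, Set.mem_empty_iff_false, iff_false]
      exact fun h => hgood ⟨κ ω.1, fun m hm => by simpa using (h (m + 1) (by lia)).1.symm⟩
  · refine ae_of_all _ fun ω n t h₁ h₂ => ?_
    rcases n with - | n
    · have : t < θ * ω.2 0 0 := by simpa [← ENNReal.coe_mul] using h₂
      simp [joint, this]
    · rw [Finset.sum_range_succ'] at h₁
      have h₃ : ((θ * ω.2 0 0 : ℝ≥0) : ℝ≥0∞) ≤ t := le_trans (by simp) h₁
      have : ¬ t < θ * ω.2 0 0 := by simpa using ENNReal.coe_le_coe.1 h₃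
      simp [joint, this]

end Joint

/-! ### The model -/

section Model

variable {A B : Type*} {d : ℕ}

/-- One of the two individual processes: `joint` before the shock, `residual` after it. -/
def individual (d : ℕ) (θ : ℝ≥0) (c : B → ℝ≥0) (κ : A → B) (i : Fin 3) (t : ℝ≥0)
    (ω : A × (Fin 3 → ℕ → ℝ≥0)) : Unit ⊕ Option (B × Fin (d + 1)) :=
  if t < θ * ω.2 0 0 then Sum.inl ()
  else Sum.inr (residual d c κ i (t - θ * ω.2 0 0) ω)

theorem individual_post_shock (θ : ℝ≥0) (c : B → ℝ≥0) (κ : A → B) (i : Fin 3)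
    (ω : A × (Fin 3 → ℕ → ℝ≥0)) (t : ℝ≥0) :
    individual d θ c κ i (shockTime (joint d θ κ) ω + t) ω =
      Sum.inr (residual d c κ i t ω) := by
  simp [shockTime_joint, individual]

variable [MeasurableSpace A]

/-- Only the shock instant itself is delicate: there the residual process must still be in stage
zero. -/
theorem individual_pre_shock (θ : ℝ≥0) {c : B → ℝ≥0} (hc : ∀ b, 0 < c b) (κ : A → B)
    (F : Measure A) [IsProbabilityMeasure F] (i : Fin 3) :
    ∀ᵐ ω ∂(F.prod expSeqs), ∀ t ≤ shockTime (joint d θ κ) ω,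
      individual d θ c κ i t ω = embed (joint d θ κ t ω) := by
  filter_upwards [(measurePreserving_noise F i).quasiMeasurePreserving.ae expSeq_pos] with ω hω t ht
  rw [shockTime_joint] at ht
  rcases ht.lt_or_eq with h | rfl
  · simp [individual, joint, h, embed]
  · simp [individual, joint, embed, residual, stage_zero (hc _) (hω 0), path_zero]

theorem cond_block (κ : A → B) (F : Measure A) [IsProbabilityMeasure F] {k : B × Fin (d + 1)}
    (hk : (F.prod expSeqs) {ω | (κ ω.1, (0 : Fin (d + 1))) = k} ≠ 0) :
    k.2 = 0 ∧ F (κ ⁻¹' {k.1}) ≠ 0 ∧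
      ProbabilityTheory.cond (F.prod expSeqs) {ω | (κ ω.1, (0 : Fin (d + 1))) = k} =
        (ProbabilityTheory.cond F (κ ⁻¹' {k.1})).prod expSeqs := by
  obtain ⟨b, j⟩ := k
  have hj : j = 0 := by
    by_contra hj
    exact hk (by simp [Ne.symm hj])
  subst hj
  have h : {ω : A × (Fin 3 → ℕ → ℝ≥0) | (κ ω.1, (0 : Fin (d + 1))) = (b, 0)} =
      (κ ⁻¹' {b}) ×ˢ Set.univ := by
    ext ω
    simp
  rw [h] at hk ⊢
  refine ⟨rfl, fun h0 => hk ?_, cond_prod_univ F _⟩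
  rw [Measure.prod_prod, h0, zero_mul]

variable [MeasurableSpace B] [DiscreteMeasurableSpace B] [Fintype B]

theorem ae_cond_fiber {κ : A → B} (hκ : Measurable κ) (F : Measure A) (b : B) :
    ∀ᵐ z ∂ProbabilityTheory.cond F (κ ⁻¹' {b}), κ z = b :=
  ae_cond_mem (hκ (measurableSet_singleton b))

/-- All three processes depend on the shared block `κ ω.1`. Once it is almost surely the constant
`b`, only the independent noise sequences remain. -/
theorem iIndep_processes (θ : ℝ≥0) (c₁ c₂ : B → ℝ≥0) {κ : A → B}
    (ν : Measure A) [IsProbabilityMeasure ν] {b : B} (hb : ∀ᵐ z ∂ν, κ z = b) :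
    iIndep ![sigmaProcess (joint d θ κ), sigmaProcess (residual d c₁ κ 1),
      sigmaProcess (residual d c₂ κ 2)] (ν.prod expSeqs) := by
  have hb' : ∀ᵐ ω ∂(ν.prod expSeqs), κ ω.1 = b :=
    (measurePreserving_fst (μ := ν) (ν := expSeqs)).quasiMeasurePreserving.ae hb
  have h₁ : iIndepFun (fun (i : Fin 3) (ω : A × (Fin 3 → ℕ → ℝ≥0)) => (b, ω.2 i))
      (ν.prod expSeqs) :=
    (iIndepFun_noise ν).comp (fun _ x => (b, x)) fun _ => by fun_prop
  have h₂ : iIndepFun (fun (i : Fin 3) (ω : A × (Fin 3 → ℕ → ℝ≥0)) => (κ ω.1, ω.2 i))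
      (ν.prod expSeqs) := by
    refine (iIndepFun_congr fun i => ?_).1 h₁
    filter_upwards [hb'] with ω hω
    rw [hω]
  refine iIndep_of_iIndep_of_le h₂ fun i => ?_
  fin_cases i
  · exact sigmaProcess_joint_le θ κ
  · exact sigmaProcess_residual_le d c₁ κ 1
  · exact sigmaProcess_residual_le d c₂ κ 2

theorem isModel [DecidableEq B] {θ : ℝ≥0} (hθ : 0 < θ) {c₁ c₂ : B → ℝ≥0} (hc₁ : ∀ b, 0 < c₁ b)
    (hc₂ : ∀ b, 0 < c₂ b) {κ : A → B} (hκ : Measurable κ) (F : Measure A)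
    [IsProbabilityMeasure F] :
    IsModel (F.prod expSeqs) (fun _ : Unit => 1) (fun _ _ => -(θ : ℝ)⁻¹) (shockRate d θ κ F)
      (erlang d c₁) (erlang d c₂) (joint d θ κ) (individual d θ c₁ κ 1) (individual d θ c₂ κ 2)
      (fun ω => (κ ω.1, 0)) (residual d c₁ κ 1) (residual d c₂ κ 2) where
  joint := isMarkovJumpProcess_joint hθ hκ F
  measurable_K k := (hκ.comp measurable_fst) (MeasurableSet.of_discrete (s := {b | (b, 0) = k}))
  shock_state := ae_of_all _ fun ω => by rw [shockTime_joint]; simp [CSPH.joint]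
  pre_shock₁ := individual_pre_shock θ hc₁ κ F 1
  pre_shock₂ := individual_pre_shock θ hc₂ κ F 2
  post_shock₁ := ae_of_all _ fun ω t => individual_post_shock θ c₁ κ 1 ω t
  post_shock₂ := ae_of_all _ fun ω t => individual_post_shock θ c₂ κ 2 ω t
  residual₁ k hk := by
    obtain ⟨h0, hF, h⟩ := cond_block κ F hk
    have := cond_isProbabilityMeasure hF
    rw [h, show k = (k.1, 0) from Prod.ext rfl h0]
    exact isMarkovJumpProcess_residual hc₁ hκ _ (ae_cond_fiber hκ F k.1) 1
  residual₂ k hk := by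
    obtain ⟨h0, hF, h⟩ := cond_block κ F hk
    have := cond_isProbabilityMeasure hF
    rw [h, show k = (k.1, 0) from Prod.ext rfl h0]
    exact isMarkovJumpProcess_residual hc₂ hκ _ (ae_cond_fiber hκ F k.1) 2
  indep k hk := by
    obtain ⟨-, hF, h⟩ := cond_block κ F hk
    have := cond_isProbabilityMeasure hF
    rw [h]
    exact iIndep_processes θ c₁ c₂ _ (ae_cond_fiber hκ F k.1)

end Model

/-! ### The response pair and its law. -/

/-- The pair `(X₁, X₂)` in the model with block map `κ`. -/
def response {A B : Type*} (d : ℕ) (a₁ a₂ : ℝ) (θ : ℝ≥0) (c₁ c₂ : B → ℝ≥0) (κ : A → B)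
    (ω : A × (Fin 3 → ℕ → ℝ≥0)) : ℝ × ℝ :=
  (a₁ * (θ * ω.2 0 0) + c₁ (κ ω.1) * ∑ j ∈ Finset.range (d + 1), (ω.2 1 j : ℝ),
    a₂ * (θ * ω.2 0 0) + c₂ (κ ω.1) * ∑ j ∈ Finset.range (d + 1), (ω.2 2 j : ℝ))

section Response

variable {A B : Type} [MeasurableSpace A] [MeasurableSpace B] [DiscreteMeasurableSpace B]

theorem measurable_response (d : ℕ) (a₁ a₂ : ℝ) (θ : ℝ≥0) (c₁ c₂ : B → ℝ≥0) {κ : A → B}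
    (hκ : Measurable κ) : Measurable (response d a₁ a₂ θ c₁ c₂ κ) := by
  have h₁ : Measurable c₁ := .of_discrete
  have h₂ : Measurable c₂ := .of_discrete
  unfold response
  fun_prop

theorem isCSPH_map_response [Fintype B] (d : ℕ) (a₁ a₂ : ℝ) {θ : ℝ≥0} (hθ : 0 < θ)
    {c₁ c₂ : B → ℝ≥0} (hc₁ : ∀ b, 0 < c₁ b) (hc₂ : ∀ b, 0 < c₂ b) {κ : A → B}
    (hκ : Measurable κ) (F : Measure A) [IsProbabilityMeasure F] :
    IsCSPH a₁ a₂ ((F.prod expSeqs).map (response d a₁ a₂ θ c₁ c₂ κ)) := by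
  classical
  refine ⟨Unit, B × Fin (d + 1), inferInstance, inferInstance, _, _, _, _, _,
    isParam (d := d) hθ hκ F hc₁ hc₂, _, _, F.prod expSeqs, inferInstance, _, _, _, _, _, _,
    isModel (d := d) hθ hc₁ hc₂ hκ F, ?_⟩
  have h : (fun ω => (a₁ * (shockTime (joint d θ κ) ω : ℝ) +
      (absorptionTime (residual d c₁ κ 1) ω : ℝ), a₂ * (shockTime (joint d θ κ) ω : ℝ) +
      (absorptionTime (residual d c₂ κ 2) ω : ℝ))) = response d a₁ a₂ θ c₁ c₂ κ := by
    funext ω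
    simp [response, shockTime_joint, absorptionTime_residual]
  rw [h]
  exact ⟨(measurable_response d a₁ a₂ θ c₁ c₂ hκ).aemeasurable, rfl⟩

end Response

/-! ### Discretization of the half-line -/

/-- The index of the cell of mesh `1 / (n + 1)` that contains `x`, truncated at `n + 1`. -/
def gridIndex (n : ℕ) (x : ℝ) : Fin ((n + 1) * (n + 1) + 1) :=
  Fin.ofNat _ (min ⌊x * ((n + 1 : ℕ) : ℝ)⌋₊ ((n + 1) * (n + 1)))

/-- The right end point of a cell. -/
def gridPoint (n : ℕ) (k : Fin ((n + 1) * (n + 1) + 1)) : ℝ≥0 := ((k : ℕ) + 1) / ((n + 1 : ℕ) : ℝ≥0)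

/-- The reason for right end points: stage means stay positive even when a coordinate of `z` is
zero. -/
theorem gridPoint_pos (n : ℕ) (k : Fin ((n + 1) * (n + 1) + 1)) : 0 < gridPoint n k := by
  unfold gridPoint
  positivity

theorem measurable_gridIndex (n : ℕ) : Measurable (gridIndex n) := by
  have h : Measurable fun m : ℕ => Fin.ofNat ((n + 1) * (n + 1) + 1) (min m ((n + 1) * (n + 1))) :=
    .of_discrete
  exact h.comp (Nat.measurable_floor.comp (by fun_prop))

theorem tendsto_gridPoint {x : ℝ} (hx : 0 ≤ x) :
    Tendsto (fun n => (gridPoint n (gridIndex n x) : ℝ)) atTop (𝓝 x) := by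
  have h₁ : Tendsto (fun n : ℕ => (⌊x * ((n + 1 : ℕ) : ℝ)⌋₊ : ℝ) / ((n + 1 : ℕ) : ℝ)) atTop (𝓝 x) :=
    (tendsto_nat_floor_mul_div_atTop hx).comp
      (tendsto_natCast_atTop_atTop.comp (tendsto_add_atTop_nat 1))
  have h₂ : Tendsto (fun n : ℕ => 1 / ((n : ℝ) + 1)) atTop (𝓝 0) :=
    tendsto_one_div_add_atTop_nhds_zero_nat
  have h := h₁.add h₂
  rw [add_zero] at h
  refine h.congr' ?_
  -- From here on `x ≤ n + 1`, so neither the truncation nor the reduction modulo the size in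
  -- `Fin.ofNat` changes the index.
  filter_upwards [eventually_ge_atTop ⌈x⌉₊] with n hn
  have hxn : x ≤ ((n + 1 : ℕ) : ℝ) := (Nat.ceil_le.1 hn).trans (by simp)
  have hfl : ⌊x * ((n + 1 : ℕ) : ℝ)⌋₊ ≤ (n + 1) * (n + 1) := by
    refine Nat.floor_le_of_le ?_
    push_cast at hxn ⊢
    gcongr
  simp only [gridPoint, gridIndex, min_eq_left hfl, Fin.ofNat, Nat.mod_eq_of_lt
    (Nat.lt_succ_of_le hfl)]
  push_cast
  ring

/-- The pairs of cells. -/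
def gridIndex₂ (n : ℕ) (z : ℝ × ℝ) :
    Fin ((n + 1) * (n + 1) + 1) × Fin ((n + 1) * (n + 1) + 1) :=
  (gridIndex n z.1, gridIndex n z.2)

theorem measurable_gridIndex₂ (n : ℕ) : Measurable (gridIndex₂ n) :=
  ((measurable_gridIndex n).comp measurable_fst).prodMk
    ((measurable_gridIndex n).comp measurable_snd)

/-! ### The approximating pairs and their almost sure convergence. -/

/-- The approximating pair: mean shock time `1 / (n + 1)`, then `n + 1` stages of total mean
length `gridPoint n (gridIndex n z.i)`. -/
def approx (a₁ a₂ : ℝ) (n : ℕ) : (ℝ × ℝ) × (Fin 3 → ℕ → ℝ≥0) → ℝ × ℝ :=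
  response n a₁ a₂ ((n + 1 : ℕ) : ℝ≥0)⁻¹
    (fun k => gridPoint n k.1 / ((n + 1 : ℕ) : ℝ≥0))
    (fun k => gridPoint n k.2 / ((n + 1 : ℕ) : ℝ≥0)) (gridIndex₂ n)

theorem measurable_approx (a₁ a₂ : ℝ) (n : ℕ) : Measurable (approx a₁ a₂ n) :=
  measurable_response _ _ _ _ _ _ (measurable_gridIndex₂ n)

theorem isCSPH_map_approx (a₁ a₂ : ℝ) (n : ℕ) (F : Measure (ℝ × ℝ)) [IsProbabilityMeasure F] :
    IsCSPH a₁ a₂ ((F.prod expSeqs).map (approx a₁ a₂ n)) :=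
  isCSPH_map_response _ _ _ (by positivity) (fun _ => div_pos (gridPoint_pos _ _) (by positivity))
    (fun _ => div_pos (gridPoint_pos _ _) (by positivity)) (measurable_gridIndex₂ n) F

/-- The shock term is a fixed `e` over `n + 1`; the rest is the grid point times an average of `n +
1` exponentials. -/
theorem tendsto_approx_coord (a : ℝ) {x : ℝ} (hx : 0 ≤ x) (e : ℝ) {y : ℕ → ℝ≥0}
    (hy : Tendsto (fun n : ℕ => (∑ j ∈ Finset.range n, (y j : ℝ)) / n) atTop (𝓝 1)) :
    Tendsto (fun n : ℕ => a * ((((n + 1 : ℕ) : ℝ≥0)⁻¹ : ℝ≥0) * e) +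
      ((gridPoint n (gridIndex n x) / ((n + 1 : ℕ) : ℝ≥0) : ℝ≥0) : ℝ) *
        ∑ j ∈ Finset.range (n + 1), (y j : ℝ)) atTop (𝓝 x) := by
  have h₁ : Tendsto (fun n : ℕ => a * (1 / ((n : ℝ) + 1) * e)) atTop (𝓝 (a * (0 * e))) :=
    (tendsto_one_div_add_atTop_nhds_zero_nat.mul_const e).const_mul a
  have h₂ := (tendsto_gridPoint hx).mul (hy.comp (tendsto_add_atTop_nat 1))
  have h := h₁.add h₂
  rw [zero_mul, mul_zero, zero_add, mul_one] at h
  refine h.congr fun n => ?_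
  simp only [Function.comp_apply]
  push_cast
  ring

theorem ae_tendsto_approx (a₁ a₂ : ℝ) (F : Measure (ℝ × ℝ)) [IsProbabilityMeasure F]
    (hF : F (Set.Ici (0 : ℝ) ×ˢ Set.Ici (0 : ℝ)) = 1) :
    ∀ᵐ ω ∂(F.prod expSeqs), Tendsto (fun n => approx a₁ a₂ n ω) atTop (𝓝 ω.1) := by
  have h0 : ∀ᵐ z ∂F, z ∈ Set.Ici (0 : ℝ) ×ˢ Set.Ici (0 : ℝ) :=
    (mem_ae_iff_prob_eq_one (measurableSet_Ici.prod measurableSet_Ici)).2 hF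
  filter_upwards [(measurePreserving_fst (μ := F) (ν := expSeqs)).quasiMeasurePreserving.ae h0,
    (measurePreserving_noise F 1).quasiMeasurePreserving.ae expSeq_tendsto,
    (measurePreserving_noise F 2).quasiMeasurePreserving.ae expSeq_tendsto] with ω hω h₁ h₂
  exact (tendsto_approx_coord a₁ hω.1 _ h₁).prodMk_nhds (tendsto_approx_coord a₂ hω.2 _ h₂)

end CSPH

end

/-! ### From almost sure to weak convergence. -/

theorem mainTheorem3 (a₁ a₂ : ℝ) (ha₁ : 0 < a₁) (ha₂ : 0 < a₂)
    (F : ProbabilityMeasure (ℝ × ℝ))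
    (hF : (F : Measure (ℝ × ℝ)) (Set.Ici (0 : ℝ) ×ˢ Set.Ici (0 : ℝ)) = 1) :
    ∃ G : ℕ → ProbabilityMeasure (ℝ × ℝ),
      (∀ n, CSPH.IsCSPH a₁ a₂ (G n : Measure (ℝ × ℝ))) ∧ Tendsto G atTop (𝓝 F) := by
  have hm := CSPH.measurable_approx a₁ a₂
  refine ⟨fun n => ⟨((F : Measure (ℝ × ℝ)).prod CSPH.expSeqs).map (CSPH.approx a₁ a₂ n),
    Measure.isProbabilityMeasure_map (hm n).aemeasurable⟩,
    fun n => CSPH.isCSPH_map_approx a₁ a₂ n F, ?_⟩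
  refine ProbabilityMeasure.tendsto_iff_forall_integral_tendsto.2 fun f => ?_
  -- The limit is realised on the same space, `F` being the law of `ω.1`.
  have hlim : ∫ z, f z ∂(F : Measure (ℝ × ℝ)) =
      ∫ ω, f ω.1 ∂((F : Measure (ℝ × ℝ)).prod CSPH.expSeqs) := by
    conv_lhs => rw [← (measurePreserving_fst (μ := (F : Measure (ℝ × ℝ)))
      (ν := CSPH.expSeqs)).map_eq]
    exact integral_map (by fun_prop) (by fun_prop)
  rw [hlim]
  simp only [ProbabilityMeasure.coe_mk]
  simp_rw [fun n => integral_map (μ := (F : Measure (ℝ × ℝ)).prod CSPH.expSeqs)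
    (hm n).aemeasurable (f.continuous.aestronglyMeasurable)]
  refine tendsto_integral_of_dominated_convergence (fun _ => ‖f‖) (fun n => ?_)
    (integrable_const _) (fun n => ae_of_all _ fun ω => f.norm_coe_le_norm _) ?_
  · exact (f.continuous.measurable.comp (hm n)).aestronglyMeasurable
  · filter_upwards [CSPH.ae_tendsto_approx a₁ a₂ F hF] with ω hω
    exact (f.continuous.tendsto _).comp hω
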